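/- Let $k$ be an algebraically closed field of characteristic zero and let $\mathcal C$ be a braided fusion category over $k$, that is, a braided rigid semisimple $k$-linear abelian monoidal category with $k$-bilinear tensor product, finite-dimensional hom-spaces, finitely many isomorphism classes of simple objects, and simple unit object $I$. For a simple object $S$ let $|S|^2\in k$ be its squared norm, that is, the product of the two loops $\mathrm{ev}'\circ\mathrm{coev}$ and $\mathrm{ev}\circ\mathrm{coev}'$ formed from a duality $(\mathrm{coev}\colon I\to S\otimes T,\ \mathrm{ev}\colon T\otimes S\to I)$ and a duality $(\mathrm{coev}'\colon I\to T\otimes S,\ \mathrm{ev}'\colon S\otimes T\to I)$; it does not depend on the choices. Let $\mathrm{FPdim}(S)$ be the Frobenius-Perron dimension of $S$, i.e. the spectral radius of the matrix of tensor multiplication by $S$ on the Grothendieck group. Fix an embedding $\sigma$ of the field of algebraic numbers contained in $k$ into $\mathbb C$ (the inclusion if $k=\mathbb C$), and regard algebraic elements of $k$ as complex numbers by means of $\sigma$. Assume that $\mathcal C$ is pseudo-unitary, i.e. $\sum_{S}|S|^2=\sum_S \mathrm{FPdim}(S)^2$, the sums running over the isomorphism classes of simple objects. For an object $X$ put $$d(X)=\sum_S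 \dim\mathcal C(S,X)\,\sqrt{|S|^2},$$ with the nonnegative square root (this is the dimension of $X$ in the canonical spherical structure of $\mathcal C$, the one for which simple objects have positive dimension). Let $A$ be an étale algebra in $\mathcal C$, that is, a commutative algebra whose multiplication $A\otimes A\to A$ has a section which is a morphism of $A$-bimodules and for which $\dim\mathcal C(I,A)=1$. Then $$\dim \mathcal C(X,A)\le d(X)\quad\text{for every object }X\in\mathcal C,$$ and in particular $\dim\mathcal C(A,A)\le d(A)$. If moreover $A$ is maximally symmetric, i.e. $\dim\mathcal C(A,A)=d(A)$, then $\dim\mathcal C(X,A)=d(X)$ for every simple object $X$ of $\mathcal C$ with $\mathcal C(X,A)\ne 0$. -/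

import Mathlib

open CategoryTheory MonoidalCategory MonObj Limits

universe v u w

noncomputable section

namespace Fusion

/-- The set of isomorphism classes of simple objects of a category. -/
def Irr (C : Type u) [Category.{v} C] [HasZeroMorphisms C] : Type u :=
  {S : Skeleton C // Simple ((fromSkeleton C).obj S)}

/-- A representative of an isomorphism class of simple objects. -/
def Irr.obj {C : Type u} [Category.{v} C] [HasZeroMorphisms C] (S : Irr C) : C :=
  (fromSkeleton C).obj S.1

instance (C : Type u) [Category.{v} C] [HasZeroMorphisms C] [Finite (Irr C)] :
    Fintype (Irr C) := Fintype.ofFinite _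

instance (C : Type u) [Category.{v} C] [HasZeroMorphisms C] : DecidableEq (Irr C) :=
  Classical.decEq _

attribute [local instance] Abelian.hasFiniteBiproducts in
/-- A fusion category over `k`: a `k`-linear abelian rigid monoidal category with `k`-bilinear
tensor product and finitely many isomorphism classes of simple objects, which is semisimple (every
object is a finite direct sum of simple ones), has finite dimensional hom-spaces and a simple
unit object. -/
class FusionCategory (k : Type w) [Field k] (C : Type u) [Category.{v} C] [Abelian C] [Linear k C]
    [MonoidalCategory C] [MonoidalPreadditive C] [MonoidalLinear k C] [RigidCategory C]
    [Finite (Irr C)] : Prop where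
  semisimple : ∀ X : C, ∃ (n : ℕ) (S : Fin n → C),
    (∀ i, Simple (S i)) ∧ Nonempty (X ≅ ⨁ S)
  finite_hom : ∀ X Y : C, Module.Finite k (X ⟶ Y)
  simple_unit : Simple (𝟙_ C)

section Dimensions

variable (k : Type w) [Field k] {C : Type u} [Category.{v} C] [Abelian C] [Linear k C]
  [MonoidalCategory C]

/-- `c` is a squared norm of `X`: for some object `Y` that is both a right and a left dual of `X`,
with dualities `(coev : 𝟙 ⟶ X ⊗ Y, ev : Y ⊗ X ⟶ 𝟙)` and `(coev' : 𝟙 ⟶ Y ⊗ X, ev' : X ⊗ Y ⟶ 𝟙)`,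
the product of the two loops `ev' ∘ coev` and `ev ∘ coev'` is `c`. If `X` is simple then
rescaling one duality multiplies one loop by a scalar and divides the other one by it, so
`c` does not depend on the choices. -/
def IsSqNorm (X : C) (c : k) : Prop :=
  ∃ (Y : C) (p : ExactPairing X Y) (q : ExactPairing Y X),
    (p.coevaluation' ≫ q.evaluation') ≫ (q.coevaluation' ≫ p.evaluation') = c • 𝟙 (𝟙_ C)

open Classical in
/-- The squared norm `|X|²` of a simple object `X`. -/
def sqNorm (X : C) : k :=
  if h : ∃ c : k, IsSqNorm k X c then h.choose else 0

/-- The categorical (global) dimension of `C`, the sum of the squared norms of the simple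
objects. -/
def globalDim (C : Type u) [Category.{v} C] [Abelian C] [Linear k C] [MonoidalCategory C]
    [Finite (Irr C)] : k :=
  ∑ S : Irr C, sqNorm k S.obj

/-- The matrix of tensor multiplication by `X` on the Grothendieck group: the entry at `(Z, Y)`
is the multiplicity of the simple object `Z` in `X ⊗ Y`. -/
def fusionMatrix (X : C) : Matrix (Irr C) (Irr C) ℂ :=
  Matrix.of fun Z Y => (Module.finrank k (Z.obj ⟶ X ⊗ Y.obj) : ℂ)

/-- The Frobenius-Perron dimension of an object, the spectral radius of its fusion matrix (for a
matrix with nonnegative entries, this is the largest real eigenvalue). -/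
def fpDim [Finite (Irr C)] (X : C) : ℝ :=
  (spectralRadius ℂ (fusionMatrix k X)).toReal

/-- The Frobenius-Perron dimension of the category. -/
def fpDimCat (C : Type u) [Category.{v} C] [Abelian C] [Linear k C] [MonoidalCategory C]
    [Finite (Irr C)] : ℝ :=
  ∑ S : Irr C, fpDim k S.obj ^ 2

variable {k} [CharZero k]

open Classical in
/-- The complex number represented by an algebraic element of `k`, for a given embedding `σ` of
the field of algebraic numbers in `k` into `ℂ`. The value at transcendental elements of `k` is
irrelevant: the dimensions in a fusion category are algebraic. -/
def toComplex (σ : algebraicClosure ℚ k →+* ℂ) (x : k) : ℂ :=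
  if h : x ∈ algebraicClosure ℚ k then σ ⟨x, h⟩ else 0

/-- `C` is pseudo-unitary: its categorical dimension and its Frobenius-Perron dimension agree.
The former is an algebraic element of `k`, the latter a real number; they are compared by means
of an embedding `σ` of the algebraic elements of `k` into `ℂ`. -/
def IsPseudoUnitary (σ : algebraicClosure ℚ k →+* ℂ) (C : Type u) [Category.{v} C] [Abelian C]
    [Linear k C] [MonoidalCategory C] [Finite (Irr C)] : Prop :=
  toComplex σ (globalDim k C) = (fpDimCat k C : ℂ)

/-- The dimension `d(X)` in a pseudo-unitary fusion category. It is additive, and on a simple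
object `S` it is the positive square root of `|S|²`: in the canonical spherical structure of a
pseudo-unitary category both loops of `S` have the same value, which is positive, and their
product is `|S|²`. -/
def dim (σ : algebraicClosure ℚ k →+* ℂ) [Finite (Irr C)] (X : C) : ℝ :=
  ∑ S : Irr C, (Module.finrank k (S.obj ⟶ X) : ℝ) * √(toComplex σ (sqNorm k S.obj)).re

/-- The equality `dim C(A, A) = d(A)`, for an étale algebra `A`. -/
def IsMaximallySymmetric (σ : algebraicClosure ℚ k →+* ℂ) [Finite (Irr C)] (A : C) : Prop :=
  (Module.finrank k (A ⟶ A) : ℝ) = dim σ A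

end Dimensions

/-- An algebra `A` is separable if its multiplication `A ⊗ A ⟶ A` has a section that is a
morphism of `A`-bimodules. -/
def IsSeparable {C : Type u} [Category.{v} C] [MonoidalCategory C] (A : C) [MonObj A] : Prop :=
  ∃ s : A ⟶ A ⊗ A, s ≫ μ = 𝟙 A ∧
    A ◁ s ≫ (α_ A A A).inv ≫ μ ▷ A = μ ≫ s ∧
    s ▷ A ≫ (α_ A A A).hom ≫ A ◁ μ = μ ≫ s

/-- An étale algebra: commutative, separable and connected, i.e. `C(𝟙, A) = k`. -/
structure IsEtale (k : Type w) [Field k] {C : Type u} [Category.{v} C] [Abelian C] [Linear k C]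
    [MonoidalCategory C] [BraidedCategory C] (A : C) [MonObj A] : Prop where
  comm : IsCommMonObj A
  separable : IsSeparable A
  connected : Module.finrank k (𝟙_ C ⟶ A) = 1

end Fusion

end

/-! The bound is the composite of `finrank_le_fpDim`, dim C(X,A) ≤ FPdim(X), with
`IsPseudoUnitary.sqrt_sqNorm_eq`, √|S|² = FPdim(S). Both rest on one Perron-Frobenius estimate,
`le_spectralRadius_of_smul_le_vecMul`.

For the first, separability and connectedness give dim C(X,A) · dim C(Y,A) ≤ dim C(X⊗Y,A)
(`finrank_mul_le`). So the vector S ↦ dim C(S,A) is a super-eigenvector of the fusion matrix of X,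
for the value dim C(X,A).

For the second, no spherical structure is constructed. Closing a strand with a braiding gives a
cyclic trace. Its value on the double braiding is multiplicative, and the double braiding, suitably
rescaled on C(U, S⊗T), is an involution. Its traces there are integers bounded by the fusion
multiplicities, so suitable square roots of the |S|² multiply with these signed coefficients
(`exists_signed_character`). Hence their absolute values are at most FPdim(S), and pseudo-unitarity
forces equality for every S.

Maximal symmetry is equality in a sum of termwise inequalities over the simple objects. -/

noncomputable section

namespace Fusion

/-! ### Lower bounds for the spectral radius of a nonnegative matrix -/

section SpectralRadius

attribute [local instance] Matrix.linftyOpNormedRing Matrix.linftyOpNormedAlgebra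

/-- A nonnegative matrix with a nonzero nonnegative row vector `v` such that `c • v ≤ v * N` has
spectral radius at least `c`. -/
theorem le_spectralRadius_of_smul_le_vecMul {J : Type*} [Fintype J] [DecidableEq J]
    (N : J → J → ℝ) (hN : ∀ i j, 0 ≤ N i j) (v : J → ℝ) (hv : ∀ i, 0 ≤ v i) (hv0 : ∃ i, v i ≠ 0)
    (c : ℝ) (hc : 0 ≤ c) (h : ∀ j, c * v j ≤ ∑ i, v i * N i j) :
    c ≤ (spectralRadius ℂ (Matrix.of fun i j => (N i j : ℂ))).toReal := by
  set M : Matrix J J ℂ := Matrix.of fun i j => (N i j : ℂ) with hM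
  have hpow : ∀ n j, c ^ n * v j ≤ ∑ i, v i * ((Matrix.of N) ^ n) i j := by
    intro n
    induction n with
    | zero => intro j; simp [Matrix.one_apply]
    | succ n ih =>
      intro j
      calc c ^ (n + 1) * v j = c ^ n * (c * v j) := by ring
        _ ≤ c ^ n * ∑ i, v i * N i j := by gcongr; exact h j
        _ = ∑ i, (c ^ n * v i) * N i j := by
          rw [Finset.mul_sum]; exact Finset.sum_congr rfl fun i _ => by ring
        _ ≤ ∑ i, (∑ l, v l * ((Matrix.of N) ^ n) l i) * N i j := by
          gcongr with i _
          · exact hN i j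
          · exact ih i
        _ = ∑ l, v l * ((Matrix.of N) ^ (n + 1)) l j := by
          simp only [pow_succ, Matrix.mul_apply, Finset.sum_mul, Finset.mul_sum]
          rw [Finset.sum_comm]
          exact Finset.sum_congr rfl fun i _ => Finset.sum_congr rfl fun l _ => by
            simp only [_root_.mul_assoc, Matrix.of_apply]
  obtain ⟨j₀, hj₀⟩ := hv0
  have hj₀' : 0 < v j₀ := lt_of_le_of_ne (hv j₀) (Ne.symm hj₀)
  have hMpow : ∀ n, M ^ n = (Matrix.of N ^ n).map (Complex.ofRealHom : ℝ →+* ℂ) := by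
    intro n
    rw [Matrix.map_pow]
    rfl
  have hentry : ∀ (B : Matrix J J ℂ) i j, ‖B i j‖ ≤ ‖B‖ := by
    intro B i j
    rw [Matrix.linfty_opNorm_def]
    have h1 : ‖B i j‖₊ ≤ ∑ j, ‖B i j‖₊ :=
      Finset.single_le_sum (f := fun j => ‖B i j‖₊) (fun _ _ => zero_le) (Finset.mem_univ j)
    have h2 : ∑ j, ‖B i j‖₊ ≤ Finset.univ.sup fun i => ∑ j, ‖B i j‖₊ :=
      Finset.le_sup (f := fun i => ∑ j, ‖B i j‖₊) (Finset.mem_univ i)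
    exact_mod_cast h1.trans h2
  set V : ℝ := ∑ i, v i with hV
  have hVpos : 0 < V := lt_of_lt_of_le hj₀' (Finset.single_le_sum (fun i _ => hv i) (Finset.mem_univ j₀))
  -- Bounding every entry of `M ^ n` by its norm turns the iterated inequality into growth of the
  -- norms; Gelfand's formula then applies, the constant disappearing under n-th roots.
  have hbound : ∀ n, c ^ n * (v j₀ / V) ≤ ‖M ^ n‖ := by
    intro n
    rw [← mul_div_assoc, div_le_iff₀ hVpos]
    refine (hpow n j₀).trans ?_
    rw [hV, Finset.mul_sum]
    refine Finset.sum_le_sum fun i _ => ?_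
    rw [mul_comm]
    refine mul_le_mul_of_nonneg_right ?_ (hv i)
    refine le_trans ?_ (hentry _ i j₀)
    rw [hMpow]
    simpa using le_abs_self _
  have hlim := spectrum.pow_norm_pow_one_div_tendsto_nhds_spectralRadius M
  have : Nonempty J := ⟨j₀⟩
  have hfin : spectralRadius ℂ M ≠ ⊤ :=
    ne_top_of_le_ne_top ENNReal.coe_ne_top (spectrum.spectralRadius_le_nnnorm M)
  have hlim' := (ENNReal.tendsto_toReal hfin).comp hlim
  have hr : 0 < v j₀ / V := div_pos hj₀' hVpos
  have hleft : Filter.Tendsto (fun n : ℕ => c * (v j₀ / V) ^ (1 / n : ℝ)) Filter.atTop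
      (nhds (c * 1)) := by
    refine Filter.Tendsto.const_mul c ?_
    have := (Real.continuousAt_const_rpow (b := 0) hr.ne').tendsto.comp
      (tendsto_one_div_atTop_nhds_zero_nat (𝕜 := ℝ))
    simpa [Function.comp_def] using this
  rw [_root_.mul_one] at hleft
  refine le_of_tendsto_of_tendsto hleft hlim' ?_
  filter_upwards [Filter.eventually_gt_atTop 0] with n hn
  have hn' : (n : ℝ) ≠ 0 := by exact_mod_cast hn.ne'
  simp only [Function.comp]
  rw [ENNReal.toReal_ofReal (by positivity)]
  calc c * (v j₀ / V) ^ (1 / n : ℝ) = (c ^ n * (v j₀ / V)) ^ (1 / n : ℝ) := by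
        rw [Real.mul_rpow (by positivity) hr.le, ← Real.rpow_natCast, ← Real.rpow_mul hc,
          mul_one_div_cancel hn', Real.rpow_one]
    _ ≤ _ := Real.rpow_le_rpow (by positivity) (hbound n) (by positivity)

end SpectralRadius

/-! ### Duality and mates -/

section Pairing

variable {C : Type u} [Category.{v} C] [MonoidalCategory C]

theorem hom_eq_of_coevaluation_comp_eq {X Y Z : C} [ExactPairing X Y] {f g : X ⟶ Z}
    (h : η_ X Y ≫ f ▷ Y = η_ X Y ≫ g ▷ Y) : f = g := by
  have := congrArg (tensorRightHomEquiv _ X Y _).symm h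
  simpa using this

theorem exists_coevaluation_comp_eq {X Y Z : C} [ExactPairing X Y] (h : 𝟙_ C ⟶ Z ⊗ Y) :
    ∃ f : X ⟶ Z, η_ X Y ≫ f ▷ Y = h := by
  refine ⟨(λ_ X).inv ≫ (tensorRightHomEquiv _ X Y _).symm h, ?_⟩
  apply (tensorRightHomEquiv _ X Y _).symm.injective
  rw [tensorRightHomEquiv_symm_coevaluation_comp_whiskerRight, Iso.hom_inv_id_assoc]

theorem exists_mate {X Y X' Y' : C} [ExactPairing X Y] [ExactPairing X' Y'] (f : X ⟶ X') :
    ∃ g : Y' ⟶ Y, η_ X' Y' ≫ X' ◁ g = η_ X Y ≫ f ▷ Y ∧ g ▷ X ≫ ε_ X Y = Y' ◁ f ≫ ε_ X' Y' := by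
  let _ : HasRightDual X := ⟨Y⟩
  let _ : HasRightDual X' := ⟨Y'⟩
  exact ⟨rightAdjointMate f, coevaluation_comp_rightAdjointMate f,
    rightAdjointMate_comp_evaluation f⟩

end Pairing

/-! ### The double braiding -/

section Braided

variable {C : Type u} [Category.{v} C] [MonoidalCategory C] [BraidedCategory C]

/-- The double braiding. -/
def psi (X Y : C) : X ⊗ Y ⟶ X ⊗ Y := (β_ X Y).hom ≫ (β_ Y X).hom

/-- A curl in the two-strand cable `X₁ ⊗ X₂` contains a full twist of the strands, which `psi`
undoes. What remains is a curl of `X₁` nested inside a curl of `X₂`; the proof slides each cup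
through the other strand by naturality. -/
theorem coevaluation_tensor_psi_braiding (X₁ X₂ Y₁ Y₂ : C) [ExactPairing X₁ Y₁]
    [ExactPairing X₂ Y₂] :
    η_ (X₁ ⊗ X₂) (Y₂ ⊗ Y₁) ≫ psi X₁ X₂ ▷ (Y₂ ⊗ Y₁) ≫ (β_ (X₁ ⊗ X₂) (Y₂ ⊗ Y₁)).hom =
      (η_ X₂ Y₂ ≫ (β_ X₂ Y₂).hom) ⊗≫ (Y₂ ◁ (η_ X₁ Y₁ ≫ (β_ X₁ Y₁).hom)) ▷ X₂ ⊗≫ 𝟙 _ := by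
  calc _ = η_ X₁ Y₁ ⊗≫ (X₁ ◁ η_ X₂ Y₂) ▷ Y₁ ⊗≫ (β_ X₁ X₂).hom ▷ (Y₂ ⊗ Y₁) ⊗≫
        ((β_ X₂ X₁).hom ▷ Y₂ ≫ (β_ (X₁ ⊗ X₂) Y₂).hom) ▷ Y₁ ⊗≫
          Y₂ ◁ (β_ (X₁ ⊗ X₂) Y₁).hom ⊗≫ 𝟙 _ := by
        rw [ExactPairing.tensor_coevaluation, BraidedCategory.braiding_tensor_right_hom, psi]
        monoidal
    _ = η_ X₁ Y₁ ⊗≫ (X₁ ◁ η_ X₂ Y₂) ▷ Y₁ ⊗≫ (β_ X₁ X₂).hom ▷ (Y₂ ⊗ Y₁) ⊗≫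
        ((β_ (X₂ ⊗ X₁) Y₂).hom ≫ Y₂ ◁ (β_ X₂ X₁).hom) ▷ Y₁ ⊗≫
          Y₂ ◁ (β_ (X₁ ⊗ X₂) Y₁).hom ⊗≫ 𝟙 _ := by
        rw [BraidedCategory.braiding_naturality_left]
    _ = η_ X₁ Y₁ ⊗≫ (X₁ ◁ η_ X₂ Y₂ ≫ (β_ X₁ (X₂ ⊗ Y₂)).hom) ▷ Y₁ ⊗≫
        ((β_ X₂ Y₂).hom ▷ X₁) ▷ Y₁ ⊗≫
          Y₂ ◁ ((β_ X₂ (X₁ ⊗ Y₁)).hom ⊗≫ (β_ X₁ Y₁).hom ▷ X₂) ⊗≫ 𝟙 _ := by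
        simp only [BraidedCategory.braiding_tensor_right_hom,
          BraidedCategory.braiding_tensor_left_hom]
        monoidal
    _ = η_ X₁ Y₁ ⊗≫ ((β_ X₁ (𝟙_ C)).hom ≫ η_ X₂ Y₂ ▷ X₁) ▷ Y₁ ⊗≫
        ((β_ X₂ Y₂).hom ▷ X₁) ▷ Y₁ ⊗≫
          Y₂ ◁ ((β_ X₂ (X₁ ⊗ Y₁)).hom ⊗≫ (β_ X₁ Y₁).hom ▷ X₂) ⊗≫ 𝟙 _ := by
        rw [BraidedCategory.braiding_naturality_right]
    _ = 𝟙 _ ⊗≫ (𝟙_ C ◁ η_ X₁ Y₁ ≫ (η_ X₂ Y₂ ≫ (β_ X₂ Y₂).hom) ▷ (X₁ ⊗ Y₁)) ⊗≫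
          Y₂ ◁ ((β_ X₂ (X₁ ⊗ Y₁)).hom ⊗≫ (β_ X₁ Y₁).hom ▷ X₂) ⊗≫ 𝟙 _ := by
        rw [braiding_tensorUnit_right]
        monoidal
    _ = 𝟙 _ ⊗≫ ((η_ X₂ Y₂ ≫ (β_ X₂ Y₂).hom) ▷ 𝟙_ C) ⊗≫
          Y₂ ◁ ((X₂ ◁ η_ X₁ Y₁ ≫ (β_ X₂ (X₁ ⊗ Y₁)).hom) ⊗≫ (β_ X₁ Y₁).hom ▷ X₂) ⊗≫ 𝟙 _ := by
        rw [whisker_exchange]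
        monoidal
    _ = 𝟙 _ ⊗≫ ((η_ X₂ Y₂ ≫ (β_ X₂ Y₂).hom) ▷ 𝟙_ C) ⊗≫
          Y₂ ◁ (((β_ X₂ (𝟙_ C)).hom ≫ η_ X₁ Y₁ ▷ X₂) ⊗≫ (β_ X₁ Y₁).hom ▷ X₂) ⊗≫ 𝟙 _ := by
        rw [BraidedCategory.braiding_naturality_right]
    _ = _ := by
        rw [braiding_tensorUnit_right]
        monoidal

theorem psi_naturality_left {X X' : C} (f : X ⟶ X') (Y : C) :
    psi X Y ≫ f ▷ Y = f ▷ Y ≫ psi X' Y := by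
  simp [psi]

theorem psi_naturality_left_assoc {X X' : C} (f : X ⟶ X') (Y : C) {Z : C} (h : X' ⊗ Y ⟶ Z) :
    psi X Y ≫ f ▷ Y ≫ h = f ▷ Y ≫ psi X' Y ≫ h := by
  rw [← Category.assoc, psi_naturality_left, Category.assoc]

theorem psi_naturality_right (X : C) {Y Y' : C} (f : Y ⟶ Y') :
    psi X Y ≫ X ◁ f = X ◁ f ≫ psi X Y' := by
  simp [psi]

theorem psi_naturality_right_assoc (X : C) {Y Y' : C} (f : Y ⟶ Y') {Z : C} (h : X ⊗ Y' ⟶ Z) :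
    psi X Y ≫ X ◁ f ≫ h = X ◁ f ≫ psi X Y' ≫ h := by
  rw [← Category.assoc, psi_naturality_right, Category.assoc]

/-- The inverse of the double braiding. -/
def psiInv (X Y : C) : X ⊗ Y ⟶ X ⊗ Y := (β_ Y X).inv ≫ (β_ X Y).inv

@[simp]
theorem psi_psiInv (X Y : C) : psi X Y ≫ psiInv X Y = 𝟙 _ := by simp [psi, psiInv]

@[simp]
theorem psiInv_psi (X Y : C) : psiInv X Y ≫ psi X Y = 𝟙 _ := by simp [psi, psiInv]

theorem coevaluation_tensor_psiInv_braiding (X₁ X₂ Y₁ Y₂ : C) [ExactPairing X₁ Y₁]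
    [ExactPairing X₂ Y₂] :
    η_ (X₁ ⊗ X₂) (Y₂ ⊗ Y₁) ≫ psiInv X₁ X₂ ▷ (Y₂ ⊗ Y₁) ≫ (β_ (Y₂ ⊗ Y₁) (X₁ ⊗ X₂)).inv =
      (η_ X₂ Y₂ ≫ (β_ Y₂ X₂).inv) ⊗≫ (Y₂ ◁ (η_ X₁ Y₁ ≫ (β_ Y₁ X₁).inv)) ▷ X₂ ⊗≫ 𝟙 _ :=
  @coevaluation_tensor_psi_braiding C _ _ (reverseBraiding C) X₁ X₂ Y₁ Y₂ _ _

end Braided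

/-! ### The twisted trace -/

section Trace

variable {C : Type u} [Category.{v} C] [MonoidalCategory C] [BraidedCategory C]

/-- The twisted trace of an endomorphism, obtained by closing it up with a braiding. -/
def loop (X Y : C) [ExactPairing X Y] (f : X ⟶ X) : 𝟙_ C ⟶ 𝟙_ C :=
  η_ X Y ≫ f ▷ Y ≫ (β_ X Y).hom ≫ ε_ X Y

/-- The mate of `f` carries it around the cup, through the braiding and off the cap, so cyclicity
needs no pivotal structure. -/
theorem loop_comp_comm {X Y X' Y' : C} [ExactPairing X Y] [ExactPairing X' Y']
    (f : X ⟶ X') (g : X' ⟶ X) : loop X Y (f ≫ g) = loop X' Y' (g ≫ f) := by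
  obtain ⟨m, h1, h2⟩ := exists_mate (Y := Y) (Y' := Y') f
  simp only [loop, comp_whiskerRight, Category.assoc]
  rw [← reassoc_of% h1, whisker_exchange_assoc, BraidedCategory.braiding_naturality_right_assoc, h2,
    BraidedCategory.braiding_naturality_left_assoc,
    BraidedCategory.braiding_naturality_left_assoc (f := f),
    BraidedCategory.braiding_naturality_left_assoc]

theorem loop_tensor_psi (X₁ X₂ Y₁ Y₂ : C) [ExactPairing X₁ Y₁] [ExactPairing X₂ Y₂] :
    loop (X₁ ⊗ X₂) (Y₂ ⊗ Y₁) (psi X₁ X₂) =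
      η_ X₂ Y₂ ≫ (β_ X₂ Y₂).hom ⊗≫ (Y₂ ◁ loop X₁ Y₁ (𝟙 X₁)) ▷ X₂ ⊗≫ ε_ X₂ Y₂ := by
  have := coevaluation_tensor_psi_braiding X₁ X₂ Y₁ Y₂ =≫ ε_ (X₁ ⊗ X₂) (Y₂ ⊗ Y₁)
  simp only [Category.assoc] at this
  rw [loop, this, ExactPairing.tensor_evaluation, loop]
  monoidal

theorem loop_unit : loop (𝟙_ C) (𝟙_ C) (𝟙 (𝟙_ C)) = 𝟙 _ := by
  rw [loop]
  change (ρ_ _).inv ≫ 𝟙 (𝟙_ C) ▷ 𝟙_ C ≫ (β_ (𝟙_ C) (𝟙_ C)).hom ≫ (ρ_ _).hom = 𝟙 _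
  simp [unitors_inv_equal]

end Trace

/-! ### Twist scalars and the square of the double braiding -/

section LinearTwist

variable {k : Type w} [Field k] {C : Type u} [Category.{v} C] [Preadditive C] [Linear k C]
  [MonoidalCategory C] [MonoidalPreadditive C] [MonoidalLinear k C] [BraidedCategory C]

theorem loop_tensor_psi_eq_smul {X₁ X₂ Y₁ Y₂ : C} [ExactPairing X₁ Y₁] [ExactPairing X₂ Y₂]
    {d₁ d₂ : k} (h₁ : loop X₁ Y₁ (𝟙 X₁) = d₁ • 𝟙 _) (h₂ : loop X₂ Y₂ (𝟙 X₂) = d₂ • 𝟙 _) :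
    loop (X₁ ⊗ X₂) (Y₂ ⊗ Y₁) (psi X₁ X₂) = (d₁ * d₂) • 𝟙 _ := by
  rw [loop_tensor_psi, h₁, mul_smul, ← h₂, loop]
  simp [monoidalComp]

/-- `t` is the twist scalar of `X`. -/
def IsTwist (X Y : C) [ExactPairing X Y] (t : k) : Prop :=
  η_ X Y ≫ psi X Y = t • η_ X Y

omit [MonoidalPreadditive C] [MonoidalLinear k C] in
theorem IsTwist.braiding_eq {X Y : C} [ExactPairing X Y] {t : k} (h : IsTwist X Y t) :
    η_ X Y ≫ (β_ X Y).hom = t • (η_ X Y ≫ (β_ Y X).inv) := by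
  have := h =≫ (β_ Y X).inv
  simpa [psi] using this

/-- The unlinked pictures for the braiding and for its reverse differ by one factor `tᵢ` per strand.
Comparing them gives a squared form of the balancing relation. -/
theorem IsTwist.coevaluation_tensor {X₁ X₂ Y₁ Y₂ : C} [ExactPairing X₁ Y₁] [ExactPairing X₂ Y₂]
    {t₁ t₂ : k} (h₁ : IsTwist X₁ Y₁ t₁) (h₂ : IsTwist X₂ Y₂ t₂) :
    η_ (X₁ ⊗ X₂) (Y₂ ⊗ Y₁) ≫ psi (X₁ ⊗ X₂) (Y₂ ⊗ Y₁) ≫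
      (psi X₁ X₂ ≫ psi X₁ X₂) ▷ (Y₂ ⊗ Y₁) = (t₁ * t₂) • η_ (X₁ ⊗ X₂) (Y₂ ⊗ Y₁) := by
  have h := coevaluation_tensor_psi_braiding X₁ X₂ Y₁ Y₂
  rw [h₁.braiding_eq, h₂.braiding_eq] at h
  have h' : η_ (X₁ ⊗ X₂) (Y₂ ⊗ Y₁) ≫ psi X₁ X₂ ▷ (Y₂ ⊗ Y₁) ≫ (β_ (X₁ ⊗ X₂) (Y₂ ⊗ Y₁)).hom =
      (t₁ * t₂) • (η_ (X₁ ⊗ X₂) (Y₂ ⊗ Y₁) ≫ psiInv X₁ X₂ ▷ (Y₂ ⊗ Y₁) ≫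
        (β_ (Y₂ ⊗ Y₁) (X₁ ⊗ X₂)).inv) := by
    rw [h, coevaluation_tensor_psiInv_braiding]
    simp [monoidalComp, smul_smul]
  have h2 := h' =≫ ((β_ (Y₂ ⊗ Y₁) (X₁ ⊗ X₂)).hom ≫ psi X₁ X₂ ▷ _)
  simp only [Category.assoc, Linear.smul_comp, Iso.inv_hom_id_assoc] at h2
  rw [← comp_whiskerRight, psiInv_psi, id_whiskerRight, Category.comp_id] at h2
  rw [← h2, comp_whiskerRight, psi_naturality_left_assoc]
  simp [psi]

/-- Naturality moves `f` across the double braiding with the dual, so the twist of `U` can be traded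
for that of `X₁ ⊗ X₂`. Thus, when `t ≠ 0`, the squared double braiding acts on maps from `U` by the
scalar t₁t₂/t. -/
theorem IsTwist.smul_comp_psi_psi {X₁ X₂ Y₁ Y₂ U V : C} [ExactPairing X₁ Y₁] [ExactPairing X₂ Y₂]
    [ExactPairing U V] {t₁ t₂ t : k} (h₁ : IsTwist X₁ Y₁ t₁) (h₂ : IsTwist X₂ Y₂ t₂)
    (h : IsTwist U V t) (f : U ⟶ X₁ ⊗ X₂) :
    t • (f ≫ psi X₁ X₂ ≫ psi X₁ X₂) = (t₁ * t₂) • f := by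
  apply hom_eq_of_coevaluation_comp_eq (Y := V)
  obtain ⟨m, hm, -⟩ := exists_mate (Y := V) (Y' := Y₂ ⊗ Y₁) f
  have e : η_ U V ≫ (t • (f ≫ psi X₁ X₂ ≫ psi X₁ X₂)) ▷ V =
      (t • η_ U V) ≫ f ▷ V ≫ (psi X₁ X₂ ≫ psi X₁ X₂) ▷ V := by
    simp
  rw [e, ← h, Category.assoc, psi_naturality_left_assoc, ← reassoc_of% hm,
    ← psi_naturality_right_assoc, whisker_exchange,
    ← Category.assoc (psi _ _), ← Category.assoc (η_ _ _), h₁.coevaluation_tensor h₂,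
    Linear.smul_comp, hm, MonoidalLinear.smul_whiskerRight, Linear.comp_smul]

end LinearTwist

/-! ### Traces of involutions -/

section Involution

/-- The trace of an involution in characteristic zero is an integer bounded by the dimension. -/
theorem exists_int_trace_of_involution {k V : Type*} [Field k] [CharZero k] [AddCommGroup V]
    [Module k V] [Module.Finite k V] (E : V →ₗ[k] V) (hE : E ∘ₗ E = LinearMap.id) :
    ∃ t : ℤ, LinearMap.trace k V E = t ∧ |t| ≤ Module.finrank k V := by
  -- `P` projects onto the +1 eigenspace, so the trace of `E` is 2 · rank P − dim V.
  set P : V →ₗ[k] V := (2⁻¹ : k) • (LinearMap.id + E) with hP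
  have hEE : ∀ x, E (E x) = x := fun x => LinearMap.congr_fun hE x
  have h2 : (2 : k) ≠ 0 := two_ne_zero
  have hidem : IsIdempotentElem P := by
    ext x
    simp only [hP, Module.End.mul_apply, LinearMap.smul_apply, LinearMap.add_apply,
      LinearMap.id_apply, map_smul, map_add, hEE, add_comm (E x) x]
    rw [← smul_add, ← two_smul k (x + E x), smul_smul (2⁻¹ : k) 2, inv_mul_cancel₀ h2, one_smul]
  have htr := (LinearMap.IsIdempotentElem.isProj_range P hidem).trace
  refine ⟨2 * Module.finrank k (LinearMap.range P) - Module.finrank k V, ?_, ?_⟩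
  · have hE' : E = (2 : k) • P - LinearMap.id := by
      rw [hP, smul_smul, mul_inv_cancel₀ h2, one_smul]; abel
    rw [hE', map_sub, map_smul, htr, LinearMap.trace_id]
    push_cast
    rw [smul_eq_mul]
  · have := Submodule.finrank_le (LinearMap.range P)
    rw [abs_le]
    constructor <;> omega

end Involution

/-! ### Semisimplicity and cyclic functionals -/

section Semisimple

variable (k : Type w) [Field k] {C : Type u} [Category.{v} C] [Abelian C] [Linear k C]
  [MonoidalCategory C] [MonoidalPreadditive C] [MonoidalLinear k C] [RigidCategory C]
  [Finite (Irr C)] [FusionCategory k C]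

omit [MonoidalCategory C] [MonoidalPreadditive C] [RigidCategory C] [Finite (Irr C)] in
instance Irr.simple (S : Irr C) : Simple S.obj := S.2

omit [MonoidalCategory C] [MonoidalPreadditive C] [RigidCategory C] [Finite (Irr C)] in
theorem Irr.eq_of_iso {S T : Irr C} (e : S.obj ≅ T.obj) : S = T := by
  apply Subtype.ext
  exact skeleton_skeletal C ⟨(fromSkeleton C).preimageIso e⟩

omit [MonoidalCategory C] [MonoidalPreadditive C] [RigidCategory C] [Finite (Irr C)] in
theorem Irr.exists_iso (X : C) [Simple X] : ∃ S : Irr C, Nonempty (X ≅ S.obj) :=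
  ⟨⟨toSkeleton X, Simple.of_iso (fromSkeletonToSkeletonIso X)⟩,
    ⟨(fromSkeletonToSkeletonIso X).symm⟩⟩

include k

theorem exists_decomposition (X : C) :
    ∃ (n : ℕ) (S : Fin n → Irr C) (p : ∀ i, X ⟶ (S i).obj) (j : ∀ i, (S i).obj ⟶ X),
      ∑ i, p i ≫ j i = 𝟙 X := by
  obtain ⟨n, S, hS, ⟨e⟩⟩ := FusionCategory.semisimple k X
  have := Abelian.hasFiniteBiproducts (C := C)
  choose T hT using fun i => @Irr.exists_iso C _ _ (S i) (hS i)
  refine ⟨n, T, fun i => e.hom ≫ biproduct.π S i ≫ (hT i).some.hom,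
    fun i => (hT i).some.inv ≫ biproduct.ι S i ≫ e.inv, ?_⟩
  have h := biproduct.total (f := S)
  calc _ = e.hom ≫ (∑ i, biproduct.π S i ≫ biproduct.ι S i) ≫ e.inv := by
        rw [Preadditive.sum_comp, Preadditive.comp_sum]
        exact Finset.sum_congr rfl fun i _ => by simp
    _ = _ := by rw [h]; simp

theorem finite_hom (X Y : C) : Module.Finite k (X ⟶ Y) := FusionCategory.finite_hom X Y

theorem isSplitEpi_of_epi {X Y : C} (g : X ⟶ Y) [Epi g] : ∃ s : Y ⟶ X, s ≫ g = 𝟙 Y := by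
  have key : ∀ (Z : C) (S : Irr C) (f : Z ⟶ S.obj), Epi f → ∃ s : S.obj ⟶ Z, s ≫ f = 𝟙 _ := by
    intro Z S f hf
    obtain ⟨n, T, p, j, hpj⟩ := exists_decomposition k Z
    have : ∃ i, j i ≫ f ≠ 0 := by
      by_contra! h
      have hf0 : f = 0 := by
        rw [← Category.id_comp f, ← hpj, Preadditive.sum_comp]
        simp [h]
      subst hf0
      exact id_nonzero S.obj (by rw [← cancel_epi (0 : Z ⟶ S.obj)]; simp)
    obtain ⟨i, hi⟩ := this
    have := isIso_of_hom_simple hi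
    exact ⟨inv (j i ≫ f) ≫ j i, by simp⟩
  obtain ⟨n, T, p, j, hpj⟩ := exists_decomposition k Y
  have : ∀ i, ∃ s : (T i).obj ⟶ X, s ≫ g = j i := by
    intro i
    -- Epimorphisms are stable under pullback in an abelian category, which reduces the splitting to
    -- a simple target.
    obtain ⟨s, hs⟩ := key _ (T i) (pullback.snd g (j i)) inferInstance
    exact ⟨s ≫ pullback.fst _ _, by rw [Category.assoc, pullback.condition, reassoc_of% hs]⟩
  choose s hs using this
  exact ⟨∑ i, p i ≫ s i, by simp [Preadditive.sum_comp, hs, hpj]⟩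

theorem exists_retraction_of_mono {X Y : C} (f : X ⟶ Y) [Mono f] : ∃ r : Y ⟶ X, f ≫ r = 𝟙 X := by
  obtain ⟨s, hs⟩ := isSplitEpi_of_epi k (cokernel.π f)
  have h0 : (𝟙 Y - cokernel.π f ≫ s) ≫ cokernel.π f = 0 := by
    simp [Preadditive.sub_comp, hs]
  refine ⟨Abelian.monoLift f _ h0, ?_⟩
  rw [← cancel_mono f, Category.assoc, Abelian.monoLift_comp]
  simp [Preadditive.comp_sub]

/-- Every morphism of a semisimple category is von Neumann regular. -/
theorem exists_pseudoinverse {X Y : C} (p : X ⟶ Y) : ∃ r : Y ⟶ X, p ≫ r ≫ p = p := by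
  obtain ⟨s, hs⟩ := isSplitEpi_of_epi k (Abelian.factorThruImage p)
  obtain ⟨r, hr⟩ := exists_retraction_of_mono k (Abelian.image.ι p)
  refine ⟨r ≫ s, ?_⟩
  have e := Abelian.image.fac p
  calc p ≫ (r ≫ s) ≫ p = (Abelian.factorThruImage p ≫ Abelian.image.ι p) ≫ (r ≫ s) ≫
        (Abelian.factorThruImage p ≫ Abelian.image.ι p) := by rw [e]
    _ = Abelian.factorThruImage p ≫ Abelian.image.ι p := by
        simp only [Category.assoc]
        rw [reassoc_of% hr, reassoc_of% hs]
    _ = p := e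

theorem cyclic_ext {V : Type*} [AddCommGroup V] [Module k V]
    (t t' : ∀ X : C, (X ⟶ X) →ₗ[k] V)
    (ht : ∀ X Y (f : X ⟶ Y) (g : Y ⟶ X), t X (f ≫ g) = t Y (g ≫ f))
    (ht' : ∀ X Y (f : X ⟶ Y) (g : Y ⟶ X), t' X (f ≫ g) = t' Y (g ≫ f))
    (h : ∀ S : Irr C, ∀ f, t S.obj f = t' S.obj f) (X : C) (f : X ⟶ X) : t X f = t' X f := by
  obtain ⟨n, S, p, j, hpj⟩ := exists_decomposition k X
  rw [← Category.id_comp f, ← hpj, Preadditive.sum_comp, map_sum, map_sum]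
  refine Finset.sum_congr rfl fun i _ => ?_
  rw [Category.assoc, ht, ht', h]

variable [IsAlgClosed k]

theorem exists_smul_id (S : C) [Simple S] (f : S ⟶ S) : ∃ c : k, c • 𝟙 S = f :=
  have := finite_hom k S S
  endomorphism_simple_eq_smul_id k f

theorem finrank_irr (S T : Irr C) :
    Module.finrank k (S.obj ⟶ T.obj) = if S = T then 1 else 0 := by
  have : ∀ X Y : C, FiniteDimensional k (X ⟶ Y) := finite_hom k
  rw [finrank_hom_simple_simple]
  congr 1
  exact propext ⟨fun ⟨e⟩ => Irr.eq_of_iso e, fun e => e ▸ ⟨Iso.refl _⟩⟩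

/-- The trace of postcomposition on a space of morphisms. -/
def traceHom (S X : C) : (X ⟶ X) →ₗ[k] k where
  toFun f := LinearMap.trace k (S ⟶ X) (Linear.rightComp k S f)
  map_add' f g := by
    rw [← map_add]; congr 1; ext x; simp
  map_smul' c f := by
    rw [RingHom.id_apply, ← map_smul]; congr 1; ext x; simp

omit [IsAlgClosed k] in
theorem traceHom_comp_comm (S : C) {X Y : C} (f : X ⟶ Y) (g : Y ⟶ X) :
    traceHom k S X (f ≫ g) = traceHom k S Y (g ≫ f) := by
  have := finite_hom k S X
  have := finite_hom k S Y
  have e : ∀ {X Y Z : C} (f : X ⟶ Y) (g : Y ⟶ Z),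
      Linear.rightComp k S (f ≫ g) = Linear.rightComp k S g ∘ₗ Linear.rightComp k S f := by
    intros; ext x; simp
  simp only [traceHom, LinearMap.coe_mk, AddHom.coe_mk, e]
  exact LinearMap.trace_comp_comm' _ _

omit [IsAlgClosed k] in
theorem traceHom_id (S X : C) : traceHom k S X (𝟙 X) = (Module.finrank k (S ⟶ X) : k) := by
  have := finite_hom k S X
  rw [← LinearMap.trace_id]
  simp only [traceHom, LinearMap.coe_mk, AddHom.coe_mk]
  congr 1
  ext x; simp

/-- Decomposing identities makes a cyclic functional depend only on its values on simple objects. By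
Schur's lemma these are fixed by the identities, and the functionals `traceHom` form the dual basis.
-/
theorem cyclic_eq_sum (t : ∀ X : C, (X ⟶ X) →ₗ[k] k)
    (ht : ∀ X Y (f : X ⟶ Y) (g : Y ⟶ X), t X (f ≫ g) = t Y (g ≫ f)) (X : C) (f : X ⟶ X) :
    t X f = ∑ S : Irr C, traceHom k S.obj X f * t S.obj (𝟙 _) := by
  have h := cyclic_ext k t (fun X => ∑ S : Irr C, t S.obj (𝟙 _) • traceHom k S.obj X) ht ?_ ?_ X f
  · rw [h]; simp [mul_comm]
  · intro X Y f g
    simp only [LinearMap.sum_apply, LinearMap.smul_apply]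
    exact Finset.sum_congr rfl fun S _ => by rw [traceHom_comp_comm]
  · intro S f
    obtain ⟨c, rfl⟩ := exists_smul_id k S.obj f
    simp [traceHom_id, finrank_irr]

/-- The trace of precomposition on C(X,A) is cyclic in X; its expansion at 𝟙 X is an identity in
`k`, and characteristic zero lifts it to ℕ. -/
theorem finrank_hom_eq_sum [CharZero k] (X A : C) :
    Module.finrank k (X ⟶ A) =
      ∑ S : Irr C, Module.finrank k (S.obj ⟶ X) * Module.finrank k (S.obj ⟶ A) := by
  have : ∀ X Y : C, FiniteDimensional k (X ⟶ Y) := finite_hom k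
  let t : ∀ X : C, (X ⟶ X) →ₗ[k] k := fun X =>
    { toFun := fun f => LinearMap.trace k (X ⟶ A) (Linear.leftComp k A f)
      map_add' := fun f g => by
        rw [← map_add]; congr 1; ext x; simp
      map_smul' := fun c f => by
        rw [RingHom.id_apply, ← map_smul]; congr 1; ext x; simp }
  have e : ∀ {X Y Z : C} (f : X ⟶ Y) (g : Y ⟶ Z),
      Linear.leftComp k A (f ≫ g) = Linear.leftComp k A f ∘ₗ Linear.leftComp k A g := by
    intros; ext x; simp
  have hid : ∀ X, t X (𝟙 X) = (Module.finrank k (X ⟶ A) : k) := by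
    intro X
    rw [← LinearMap.trace_id]
    simp only [t, LinearMap.coe_mk, AddHom.coe_mk]
    congr 1
    ext x; simp
  have h := cyclic_eq_sum k t (fun X Y f g => by
    simp only [t, LinearMap.coe_mk, AddHom.coe_mk, e]
    exact LinearMap.trace_comp_comm' _ _) X (𝟙 X)
  simp only [hid, traceHom_id] at h
  exact_mod_cast h

end Semisimple

/-! ### Separable connected algebras and supermultiplicativity -/

section Separable

variable (k : Type w) [Field k] {C : Type u} [Category.{v} C] [Abelian C] [Linear k C]
  [MonoidalCategory C] [MonoidalPreadditive C] [MonoidalLinear k C] [RigidCategory C]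
  [Finite (Irr C)] [FusionCategory k C] (A : C) [MonObj A]

omit [RigidCategory C] [Finite (Irr C)] [FusionCategory k C] [MonoidalLinear k C] in
theorem unit_ne_zero (hA : Module.finrank k (𝟙_ C ⟶ A) = 1) : (η : 𝟙_ C ⟶ A) ≠ 0 := by
  intro h0
  have hid : 𝟙 A = 0 := by
    have := MonObj.one_mul A
    rw [h0] at this
    rw [← cancel_epi (λ_ A).hom, ← this, Category.comp_id]
    simp
  have : Subsingleton (𝟙_ C ⟶ A) :=
    ⟨fun f g => by rw [← Category.comp_id f, ← Category.comp_id g, hid, comp_zero, comp_zero]⟩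
  rw [Module.finrank_zero_of_subsingleton] at hA
  exact zero_ne_one hA

/-- A Maschke argument: the `A`-linear map a ⊗ x ↦ a f(x) is nonzero, and averaging a pseudo-inverse
with `s` splits it `A`-linearly, since connectedness makes `A` simple enough that its module
endomorphisms are scalars. The dual element is the image of the unit under the splitting. -/
theorem exists_dual_element (hs : IsSeparable A) (hA : Module.finrank k (𝟙_ C ⟶ A) = 1)
    {X : C} (f : X ⟶ A) (hf : f ≠ 0) : ∃ h : 𝟙_ C ⟶ A ⊗ X, h ≫ A ◁ f ≫ μ = η := by
  obtain ⟨s, hs1, hs2, hs3⟩ := hs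
  set p : A ⊗ X ⟶ A := A ◁ f ≫ μ with hp
  obtain ⟨r, hr⟩ := exists_pseudoinverse k p
  have hp0 : p ≠ 0 := by
    intro h0
    apply hf
    have : (λ_ X).inv ≫ η ▷ X ≫ p = f := by
      rw [hp, ← whisker_exchange_assoc, MonObj.one_mul]
      simp
    rw [← this, h0]; simp
  -- Left linearity of `s` makes `e` a module endomorphism; right linearity, with `p ≫ r ≫ p = p`,
  -- gives `p ≫ e = p`.
  set e : A ⟶ A := s ≫ A ◁ (r ≫ p) ≫ μ with he
  have hmod : μ ≫ e = A ◁ e ≫ μ := by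
    rw [he, ← reassoc_of% hs2, ← whisker_exchange_assoc, MonObj.mul_assoc]
    simp
  have hpe : p ≫ e = p := by
    have h1 : p ≫ s = s ▷ X ≫ (α_ A A X).hom ≫ A ◁ p := by
      rw [hp, Category.assoc, ← hs3, whisker_exchange_assoc]
      simp
    rw [he, reassoc_of% h1, ← whiskerLeft_comp_assoc, hr, ← reassoc_of% h1, hs1, Category.comp_id]
  have hη := unit_ne_zero k A hA
  obtain ⟨c, hc⟩ := (finrank_eq_one_iff_of_nonzero' _ hη).1 hA (η ≫ e)
  have hec : e = c • 𝟙 A := by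
    calc e = (ρ_ A).inv ≫ A ◁ η ≫ μ ≫ e := by rw [← Category.assoc (A ◁ η), MonObj.mul_one]; simp
      _ = (ρ_ A).inv ≫ A ◁ (η ≫ e) ≫ μ := by rw [hmod]; simp
      _ = c • 𝟙 A := by
        rw [← hc, MonoidalLinear.whiskerLeft_smul, Linear.smul_comp, Linear.comp_smul,
          MonObj.mul_one]; simp
  have hc1 : c = 1 := by
    rw [hec] at hpe
    by_contra hne
    apply hp0
    have : (c - 1) • p = 0 := by
      rw [sub_smul, one_smul, sub_eq_zero]; simpa using hpe
    exact (smul_eq_zero.1 this).resolve_left (sub_ne_zero.2 hne)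
  refine ⟨η ≫ s ≫ A ◁ r ≫ (α_ A A X).inv ≫ μ ▷ X, ?_⟩
  have : (s ≫ A ◁ r ≫ (α_ A A X).inv ≫ μ ▷ X) ≫ A ◁ f ≫ μ = e := by
    rw [he, hp]
    simp only [Category.assoc, ← whisker_exchange_assoc, MonObj.mul_assoc]
    simp
  rw [Category.assoc, this, hec, hc1]
  simp

/-- By `exists_dual_element`, a basis `b j` of C(X,A) has dual elements `h i`. Contracting Σ b_j ·
g_j with `h i` recovers `g i`, so the family `g` embeds in C(X⊗Y,A). -/
theorem finrank_mul_le (hs : IsSeparable A) (hA : Module.finrank k (𝟙_ C ⟶ A) = 1) (X Y : C) :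
    Module.finrank k (X ⟶ A) * Module.finrank k (Y ⟶ A) ≤ Module.finrank k (X ⊗ Y ⟶ A) := by
  have : ∀ X Y : C, FiniteDimensional k (X ⟶ Y) := finite_hom k
  have hη := unit_ne_zero k A hA
  let φ : (𝟙_ C ⟶ A) ≃ₗ[k] k := (LinearEquiv.ofFinrankEq _ _ (by rw [hA, Module.finrank_self]))
  have hφη : φ η ≠ 0 := by simpa using hη
  let B : (X ⟶ A) →ₗ[k] (𝟙_ C ⟶ A ⊗ X) →ₗ[k] k := LinearMap.mk₂ k
    (fun f h => (φ η)⁻¹ * φ (h ≫ A ◁ f ≫ μ)) (by intros; simp [mul_add]) (by intros; simp; ring)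
    (by intros; simp [mul_add]) (by intros; simp; ring)
  have hB : Function.Injective B := by
    rw [injective_iff_map_eq_zero]
    intro f hf
    by_contra hne
    obtain ⟨h, hh⟩ := exists_dual_element k A hs hA f hne
    have := LinearMap.congr_fun hf h
    simp [B, hh, hφη] at this
  have hsurj : Function.Surjective B.flip := LinearMap.flip_surjective_iff₁.2 hB
  let b := Module.finBasis k (X ⟶ A)
  choose h hh using fun i => hsurj (b.coord i)
  have hval : ∀ i j, h i ≫ A ◁ b j ≫ μ = (if j = i then (1 : k) else 0) • η := by
    intro i j
    have := LinearMap.congr_fun (hh i) (b j)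
    simp only [LinearMap.flip_apply, B, LinearMap.mk₂_apply, Module.Basis.coord_apply,
      Module.Basis.repr_self, Finsupp.single_apply] at this
    apply φ.injective
    rw [map_smul, smul_eq_mul, ← this]
    field_simp
  let Ψ : (Fin (Module.finrank k (X ⟶ A)) → (Y ⟶ A)) →ₗ[k] (X ⊗ Y ⟶ A) :=
    { toFun := fun g => ∑ j, (b j ⊗ₘ g j) ≫ μ
      map_add' := fun g g' => by
        simp [MonoidalPreadditive.tensor_add, Preadditive.add_comp, Finset.sum_add_distrib]
      map_smul' := fun c g => by
        simp [MonoidalCategory.tensorHom_def, Finset.smul_sum] }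
  have hΨ : Function.Injective Ψ := by
    rw [injective_iff_map_eq_zero]
    intro g hg
    funext i
    have key : ∀ j, (λ_ Y).inv ≫ h i ▷ Y ≫ (α_ A X Y).hom ≫ A ◁ ((b j ⊗ₘ g j) ≫ μ) ≫ μ =
        if j = i then g j else 0 := by
      intro j
      calc _ = (λ_ Y).inv ≫ (h i ≫ A ◁ b j ≫ μ) ▷ Y ≫ A ◁ g j ≫ μ := by
            simp only [MonoidalCategory.tensorHom_def, whiskerLeft_comp, comp_whiskerRight, Category.assoc]
            rw [← whisker_exchange_assoc, MonObj.mul_assoc]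
            simp
        _ = (if j = i then (1 : k) else 0) • ((λ_ Y).inv ≫ η ▷ Y ≫ A ◁ g j ≫ μ) := by
            rw [hval, MonoidalLinear.smul_whiskerRight, Linear.smul_comp, Linear.comp_smul]
        _ = (if j = i then (1 : k) else 0) • g j := by
            rw [← whisker_exchange_assoc, MonObj.one_mul]; simp
        _ = _ := by split_ifs <;> simp
    have h0 : (λ_ Y).inv ≫ h i ▷ Y ≫ (α_ A X Y).hom ≫ A ◁ (Ψ g) ≫ μ = g i := by
      change (λ_ Y).inv ≫ h i ▷ Y ≫ (α_ A X Y).hom ≫ A ◁ (∑ j, (b j ⊗ₘ g j) ≫ μ) ≫ μ = g i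
      rw [whiskerLeft_sum, Preadditive.sum_comp]
      simp only [Preadditive.comp_sum, key]
      simp
    rw [← h0, hg]; simp
  have := LinearMap.finrank_le_finrank_of_injective hΨ
  simpa [Module.finrank_pi_fintype] using this

variable [IsAlgClosed k] [CharZero k]

omit [MonObj A] in
theorem finrank_tensor_eq_sum (X Y : C) :
    (Module.finrank k (X ⊗ Y ⟶ A) : ℝ) =
      ∑ S : Irr C, (Module.finrank k (S.obj ⟶ A) : ℝ) * Module.finrank k (S.obj ⟶ X ⊗ Y) := by
  rw [finrank_hom_eq_sum k]
  push_cast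
  exact Finset.sum_congr rfl fun S _ => by ring

omit [MonoidalPreadditive C] [MonoidalLinear k C] [RigidCategory C] [Finite (Irr C)]
  [FusionCategory k C] [IsAlgClosed k] [CharZero k] in
theorem fusionMatrix_eq (X : C) : fusionMatrix k X =
    Matrix.of fun Z Y : Irr C => ((Module.finrank k (Z.obj ⟶ X ⊗ Y.obj) : ℝ) : ℂ) := by
  ext; simp [fusionMatrix]

/-- The row vector S ↦ dim C(S,A) times the fusion matrix of `X` has entries dim C(X⊗T,A), so
supermultiplicativity is exactly the spectral hypothesis. The vector is nonzero because C(𝟙,A) is.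
-/
theorem finrank_le_fpDim (hs : IsSeparable A) (hA : Module.finrank k (𝟙_ C ⟶ A) = 1) (X : C) :
    (Module.finrank k (X ⟶ A) : ℝ) ≤ fpDim k X := by
  have : ∀ X Y : C, FiniteDimensional k (X ⟶ Y) := finite_hom k
  rw [fpDim, fusionMatrix_eq]
  refine le_spectralRadius_of_smul_le_vecMul _ (fun _ _ => Nat.cast_nonneg _)
    (fun S : Irr C => (Module.finrank k (S.obj ⟶ A) : ℝ)) (fun _ => Nat.cast_nonneg _) ?_ _
    (Nat.cast_nonneg _) ?_
  · by_contra! h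
    have h1 := finrank_hom_eq_sum k (𝟙_ C) A
    rw [hA] at h1
    have : ∀ S : Irr C, Module.finrank k (S.obj ⟶ A) = 0 := fun S => by exact_mod_cast h S
    simp [this] at h1
  · intro T
    rw [← finrank_tensor_eq_sum]
    exact_mod_cast finrank_mul_le k A hs hA X T.obj

end Separable

/-! ### Squared norms and the signed character -/

section Dimension

variable (k : Type w) [Field k] [IsAlgClosed k] {C : Type u} [Category.{v} C] [Abelian C]
  [Linear k C] [MonoidalCategory C] [MonoidalPreadditive C] [MonoidalLinear k C] [RigidCategory C]
  [BraidedCategory C] [Finite (Irr C)] [FusionCategory k C]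

omit [BraidedCategory C] in
theorem traceHom_unit_smul (f : 𝟙_ C ⟶ 𝟙_ C) : traceHom k (𝟙_ C) (𝟙_ C) f • 𝟙 (𝟙_ C) = f := by
  have := FusionCategory.simple_unit (k := k) (C := C)
  have := finite_hom k (𝟙_ C) (𝟙_ C)
  obtain ⟨c, rfl⟩ := exists_smul_id k (𝟙_ C) f
  rw [map_smul, traceHom_id, finrank_endomorphism_simple_eq_one]
  simp

/-- The scalar of the twisted trace of an endomorphism. -/
def loopTrace (X : C) : (X ⟶ X) →ₗ[k] k where
  toFun f := traceHom k (𝟙_ C) (𝟙_ C) (loop X Xᘁ f)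
  map_add' f g := by
    rw [← map_add]; simp [loop, MonoidalPreadditive.add_whiskerRight, Preadditive.add_comp,
      Preadditive.comp_add]
  map_smul' c f := by
    rw [RingHom.id_apply, ← map_smul]; simp [loop]

omit [IsAlgClosed k] [Finite (Irr C)] [FusionCategory k C] in
theorem loopTrace_comp_comm (X Y : C) (f : X ⟶ Y) (g : Y ⟶ X) :
    loopTrace k X (f ≫ g) = loopTrace k Y (g ≫ f) := by
  simp only [loopTrace, LinearMap.coe_mk, AddHom.coe_mk]
  rw [loop_comp_comm (Y := Xᘁ) (Y' := Yᘁ)]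

theorem loop_eq_loopTrace (X Y : C) [ExactPairing X Y] (f : X ⟶ X) :
    loop X Y f = loopTrace k X f • 𝟙 _ := by
  have := loop_comp_comm (Y := Y) (Y' := Xᘁ) f (𝟙 X)
  rw [Category.comp_id, Category.id_comp] at this
  rw [this]
  exact (traceHom_unit_smul k _).symm

omit [BraidedCategory C] [IsAlgClosed k] in
theorem smul_id_unit_injective {a b : k} (h : a • 𝟙 (𝟙_ C) = b • 𝟙 (𝟙_ C)) : a = b := by
  have := FusionCategory.simple_unit (k := k) (C := C)
  exact smul_left_injective k (id_nonzero (𝟙_ C)) h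

theorem loopTrace_tensor_psi (X Y : C) : loopTrace k (X ⊗ Y) (psi X Y) =
    loopTrace k X (𝟙 X) * loopTrace k Y (𝟙 Y) := by
  apply smul_id_unit_injective k (C := C)
  rw [← loop_eq_loopTrace k (X ⊗ Y) (Yᘁ ⊗ Xᘁ)]
  exact loop_tensor_psi_eq_smul (loop_eq_loopTrace k X Xᘁ _) (loop_eq_loopTrace k Y Yᘁ _)

theorem loopTrace_unit : loopTrace k (𝟙_ C) (𝟙 _) = 1 := by
  apply smul_id_unit_injective k (C := C)
  rw [← loop_eq_loopTrace k (𝟙_ C) (𝟙_ C), loop_unit, one_smul]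

/-- Duality identifies C(𝟙, X⊗Y) with End X = k, so the coevaluation spans it; invertibility of the
double braiding gives `t ≠ 0`. -/
theorem exists_isTwist (X Y : C) [Simple X] [ExactPairing X Y] :
    ∃ t : k, t ≠ 0 ∧ IsTwist X Y t := by
  obtain ⟨f, hf⟩ := exists_coevaluation_comp_eq (X := X) (η_ X Y ≫ psi X Y)
  obtain ⟨t, rfl⟩ := exists_smul_id k X f
  have ht : IsTwist X Y t := by
    rw [IsTwist, ← hf]; simp
  refine ⟨t, ?_, ht⟩
  rintro rfl
  have h0 : η_ X Y = 0 := by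
    rw [IsTwist, zero_smul] at ht
    have := ht =≫ psiInv X Y
    simpa using this
  apply id_nonzero X
  apply hom_eq_of_coevaluation_comp_eq (Y := Y)
  simp [h0]

omit [IsAlgClosed k] [Finite (Irr C)] [MonoidalPreadditive C] [MonoidalLinear k C]
  [RigidCategory C] [FusionCategory k C] in
theorem IsTwist.congr {k : Type w} [Field k] [Linear k C] {X Y Y' : C} [ExactPairing X Y]
    [ExactPairing X Y'] {t : k} (h : IsTwist X Y t) : IsTwist X Y' t := by
  obtain ⟨g, hg, -⟩ := exists_mate (Y := Y') (Y' := Y) (𝟙 X)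
  rw [id_whiskerRight, Category.comp_id] at hg
  rw [IsTwist] at h ⊢
  rw [← hg, Category.assoc, ← psi_naturality_right, reassoc_of% h, Linear.smul_comp]

/-- The second duality agrees with the braided swap of the first up to a scalar that cancels in the
product. The two loops then use opposite braidings and differ by the factor `t`. -/
theorem eq_of_isSqNorm {X : C} [Simple X] {t c : k} (ht0 : t ≠ 0) (ht : IsTwist X Xᘁ t)
    (hc : IsSqNorm k X c) : c = loopTrace k X (𝟙 X) ^ 2 / t := by
  obtain ⟨Y, p, q, h⟩ := hc
  let q₀ : ExactPairing Y X := BraidedCategory.exactPairing_swap X Y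
  obtain ⟨g, hg1, hg2⟩ := @exists_mate C _ _ Y X Y X q₀ q (𝟙 Y)
  obtain ⟨a, rfl⟩ := exists_smul_id k X g
  have hη : a • q.coevaluation' = p.coevaluation' ≫ (β_ Y X).inv := by
    change q.coevaluation' ≫ Y ◁ (a • 𝟙 X) = (p.coevaluation' ≫ (β_ Y X).inv) ≫ 𝟙 Y ▷ X at hg1
    simpa using hg1
  have hε : a • ((β_ X Y).hom ≫ p.evaluation') = q.evaluation' := by
    change (a • 𝟙 X) ▷ Y ≫ (β_ X Y).hom ≫ p.evaluation' = X ◁ 𝟙 Y ≫ q.evaluation' at hg2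
    simpa using hg2
  have h1 : p.coevaluation' ≫ (β_ X Y).hom ≫ p.evaluation' = loopTrace k X (𝟙 X) • 𝟙 _ := by
    rw [← loop_eq_loopTrace k X Y, loop, id_whiskerRight, Category.id_comp]; rfl
  have h2 : p.coevaluation' ≫ (β_ X Y).hom = t • (p.coevaluation' ≫ (β_ Y X).inv) :=
    (ht.congr (Y' := Y)).braiding_eq
  have h3 : p.coevaluation' ≫ (β_ Y X).inv ≫ p.evaluation' =
      (t⁻¹ * loopTrace k X (𝟙 X)) • 𝟙 _ := by
    rw [mul_smul, ← h1, reassoc_of% h2, Linear.smul_comp, smul_smul, inv_mul_cancel₀ ht0, one_smul,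
      Category.assoc]
  apply smul_id_unit_injective k (C := C)
  rw [← h, ← hε]
  calc _ = (p.coevaluation' ≫ (β_ X Y).hom ≫ p.evaluation') ≫
        ((a • q.coevaluation') ≫ p.evaluation') := by simp
    _ = _ := by
      rw [hη, h1, Category.assoc, h3, Linear.smul_comp, Linear.comp_smul, smul_smul,
        Category.comp_id]
      congr 1
      field_simp

theorem sqNorm_eq {X : C} [Simple X] {t : k} (ht0 : t ≠ 0) (ht : IsTwist X Xᘁ t) :
    sqNorm k X = loopTrace k X (𝟙 X) ^ 2 / t := by
  have hex : ∃ c : k, IsSqNorm k X c :=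
    ⟨_, Xᘁ, inferInstance, BraidedCategory.exactPairing_swap X Xᘁ, (traceHom_unit_smul k _).symm⟩
  rw [sqNorm, dif_pos hex]
  exact eq_of_isSqNorm k ht0 ht hex.choose_spec

/-- Square roots of the squared norms form a character of a signed version of the Grothendieck
ring. -/
theorem exists_signed_character [CharZero k] :
    ∃ (d : Irr C → k) (M : Irr C → Irr C → Irr C → ℤ),
      (∃ S, d S ≠ 0) ∧ (∀ S, d S ^ 2 = sqNorm k S.obj) ∧
      (∀ S T, d S * d T = ∑ U, M S U T * d U) ∧
      ∀ S T U, |M S U T| ≤ Module.finrank k (U.obj ⟶ S.obj ⊗ T.obj) := by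
  have : ∀ X Y : C, FiniteDimensional k (X ⟶ Y) := finite_hom k
  choose t ht0 ht using fun S : Irr C => exists_isTwist k S.obj S.objᘁ
  -- Any choice of roots works: changing one only flips signs in the coefficients, whose absolute
  -- values alone matter.
  choose r hr using fun S : Irr C => IsAlgClosed.exists_pow_nat_eq (t S) (n := 2) two_pos
  have hr0 : ∀ S, r S ≠ 0 := fun S h => ht0 S (by rw [← hr S, h]; simp)
  have hinv : ∀ S T U : Irr C, ∃ n : ℤ,
      traceHom k U.obj (S.obj ⊗ T.obj) (psi S.obj T.obj) * (r U / (r S * r T)) = n ∧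
        |n| ≤ Module.finrank k (U.obj ⟶ S.obj ⊗ T.obj) := by
    intro S T U
    obtain ⟨n, hn, hn'⟩ := exists_int_trace_of_involution
      ((r U / (r S * r T)) • Linear.rightComp k U.obj (psi S.obj T.obj)) (by
        ext f
        have h := (ht S).smul_comp_psi_psi (ht T) (ht U) f
        have h' : f ≫ psi S.obj T.obj ≫ psi S.obj T.obj = ((t U)⁻¹ * (t S * t T)) • f := by
          rw [mul_smul, ← h, smul_smul, inv_mul_cancel₀ (ht0 U), one_smul]
        simp only [LinearMap.comp_apply, LinearMap.smul_apply, Linear.rightComp_apply,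
          Linear.smul_comp, Category.assoc, h', smul_smul, LinearMap.id_apply, ← hr]
        have h1 := hr0 S
        have h2 := hr0 T
        have h3 := hr0 U
        convert one_smul k f using 2
        field_simp)
    refine ⟨n, ?_, hn'⟩
    rw [← hn, map_smul, smul_eq_mul, mul_comm]
    rfl
  choose M hM hM' using hinv
  refine ⟨fun S => loopTrace k S.obj (𝟙 _) / r S, fun S U T => M S T U, ?_, ?_, ?_, hM'⟩
  · have := FusionCategory.simple_unit (k := k) (C := C)
    obtain ⟨S, ⟨e⟩⟩ := Irr.exists_iso (𝟙_ C)
    refine ⟨S, div_ne_zero ?_ (hr0 S)⟩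
    have h := loopTrace_comp_comm k _ _ e.hom e.inv
    rw [e.hom_inv_id, e.inv_hom_id, loopTrace_unit] at h
    rw [← h]
    exact one_ne_zero
  · intro S
    rw [sqNorm_eq k (ht0 S) (ht S), div_pow, hr]
  · intro S T
    have h := cyclic_eq_sum k (loopTrace k) (loopTrace_comp_comm k) _ (psi S.obj T.obj)
    rw [loopTrace_tensor_psi] at h
    rw [div_mul_div_comm, h, Finset.sum_div]
    refine Finset.sum_congr rfl fun U _ => ?_
    rw [← hM]
    have h1 := hr0 S
    have h2 := hr0 T
    have h3 := hr0 U
    field_simp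

end Dimension

/-! ### Comparison with Frobenius-Perron dimensions -/

section PseudoUnitary

variable {k : Type w} [Field k] [IsAlgClosed k] [CharZero k] (σ : algebraicClosure ℚ k →+* ℂ)

omit [IsAlgClosed k] in
theorem toComplex_coe (x : algebraicClosure ℚ k) : toComplex σ (x : k) = σ x := by
  rw [toComplex, dif_pos x.2]

variable {C : Type u} [Category.{v} C] [Abelian C]
  [Linear k C] [MonoidalCategory C] [MonoidalPreadditive C] [MonoidalLinear k C] [RigidCategory C]
  [BraidedCategory C] [Finite (Irr C)] [FusionCategory k C]

/-- The triangle inequality in the signed fusion rules makes S ↦ |σ(a S)| a super-eigenvector of the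
fusion matrices. -/
theorem exists_complex_signed_character :
    ∃ a : Irr C → algebraicClosure ℚ k, (∀ S, (a S : k) ^ 2 = sqNorm k S.obj) ∧
      ∀ S, ‖σ (a S)‖ ≤ fpDim k S.obj := by
  obtain ⟨d, M, ⟨S₀, hS₀⟩, hsq, hmul, hbd⟩ := exists_signed_character k (C := C)
  have hint : ∀ S, IsIntegral ℤ (d S) := by
    intro S
    -- The ℤ-span of the values of `d` is nonzero, finitely generated and stable under
    -- multiplication by `d S`; hence `d S` is integral, and `σ` applies to it.
    refine isIntegral_of_smul_mem_submodule (Submodule.span ℤ (Set.range d)) ?_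
      (Submodule.fg_span (Set.finite_range d)) _ ?_
    · intro h
      exact hS₀ ((Submodule.span_eq_bot.1 h) _ ⟨S₀, rfl⟩)
    · intro x hx
      induction hx using Submodule.span_induction with
      | mem x hx =>
        obtain ⟨T, rfl⟩ := hx
        rw [smul_eq_mul, hmul]
        refine Submodule.sum_mem _ fun U _ => ?_
        rw [← zsmul_eq_mul]
        exact Submodule.smul_mem _ _ (Submodule.subset_span ⟨U, rfl⟩)
      | zero => simp
      | add x y _ _ hx hy => rw [smul_add]; exact Submodule.add_mem _ hx hy
      | smul n x _ hx => rw [smul_comm]; exact Submodule.smul_mem _ _ hx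
  let a : Irr C → algebraicClosure ℚ k := fun S =>
    ⟨d S, mem_algebraicClosure_iff.2 (hint S).tower_top.isAlgebraic⟩
  have hamul : ∀ S T, a S * a T = ∑ U, (M S U T : algebraicClosure ℚ k) * a U := by
    intro S T
    apply Subtype.ext
    push_cast
    exact hmul S T
  refine ⟨a, hsq, fun S => ?_⟩
  rw [fpDim, fusionMatrix_eq]
  refine le_spectralRadius_of_smul_le_vecMul _ (fun _ _ => Nat.cast_nonneg _)
    (fun S : Irr C => ‖σ (a S)‖) (fun _ => norm_nonneg _) ⟨S₀, ?_⟩ _ (norm_nonneg _) ?_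
  · rw [norm_ne_zero_iff, map_ne_zero]
    intro h
    exact hS₀ (congrArg Subtype.val h)
  · intro T
    rw [← norm_mul, ← map_mul, hamul, map_sum]
    refine (norm_sum_le _ _).trans (Finset.sum_le_sum fun U _ => ?_)
    rw [map_mul, map_intCast, norm_mul, mul_comm]
    refine mul_le_mul_of_nonneg_left ?_ (norm_nonneg _)
    rw [Complex.norm_intCast]
    exact_mod_cast hbd S T U

/-- In a pseudo-unitary braided fusion category, the positive square root of the squared norm of a
simple object is its Frobenius-Perron dimension. -/
theorem IsPseudoUnitary.sqrt_sqNorm_eq (hC : IsPseudoUnitary σ C) (S : Irr C) :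
    √(toComplex σ (sqNorm k S.obj)).re = fpDim k S.obj := by
  obtain ⟨a, hsq, hle⟩ := exists_complex_signed_character σ (C := C)
  have hpow : ∀ S, toComplex σ (sqNorm k S.obj) = σ (a S) ^ 2 := by
    intro S
    rw [← hsq, ← map_pow, ← toComplex_coe]
    rfl
  have hglob : toComplex σ (globalDim k C) = ∑ S : Irr C, σ (a S) ^ 2 := by
    have : globalDim k C = ((∑ S : Irr C, a S ^ 2 : algebraicClosure ℚ k) : k) := by
      rw [globalDim]
      push_cast
      exact Finset.sum_congr rfl fun S _ => (hsq S).symm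
    rw [this, toComplex_coe]
    simp
  have hbound : ∀ S : Irr C, (σ (a S) ^ 2).re ≤ fpDim k S.obj ^ 2 := by
    intro S
    refine (Complex.re_le_norm _).trans ?_
    rw [norm_pow]
    exact pow_le_pow_left₀ (norm_nonneg _) (hle S) 2
  have hsum : ∑ S : Irr C, (σ (a S) ^ 2).re = ∑ S : Irr C, fpDim k S.obj ^ 2 := by
    rw [IsPseudoUnitary, hglob] at hC
    have := congrArg Complex.re hC
    rwa [Complex.re_sum, Complex.ofReal_re] at this
  -- Equal sums of termwise comparable reals are equal termwise; this is where pseudo-unitarity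
  -- passes from the total to each `S`.
  have := (Finset.sum_eq_sum_iff_of_le fun S _ => hbound S).1 hsum S (Finset.mem_univ S)
  rw [hpow, this]
  exact Real.sqrt_sq ENNReal.toReal_nonneg

end PseudoUnitary

end Fusion

end

/-! ### The bound and the case of equality -/

theorem mainTheorem7 {k : Type w} [Field k] [IsAlgClosed k] [CharZero k]
    (σ : algebraicClosure ℚ k →+* ℂ)
    {C : Type u} [Category.{v} C] [Abelian C] [Linear k C] [MonoidalCategory C]
    [MonoidalPreadditive C] [MonoidalLinear k C] [RigidCategory C] [BraidedCategory C]
    [Finite (Fusion.Irr C)] [Fusion.FusionCategory k C]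
    (hC : Fusion.IsPseudoUnitary σ C)
    (A : C) [MonObj A] (hA : Fusion.IsEtale k A) :
    (∀ X : C, (Module.finrank k (X ⟶ A) : ℝ) ≤ Fusion.dim σ X) ∧
    (Module.finrank k (A ⟶ A) : ℝ) ≤ Fusion.dim σ A ∧
    (Fusion.IsMaximallySymmetric σ A →
      ∀ X : C, Simple X → (∃ f : X ⟶ A, f ≠ 0) →
        (Module.finrank k (X ⟶ A) : ℝ) = Fusion.dim σ X) := by
  have hle : ∀ S : Fusion.Irr C, (Module.finrank k (S.obj ⟶ A) : ℝ) ≤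
      √(Fusion.toComplex σ (Fusion.sqNorm k S.obj)).re := fun S => by
    rw [hC.sqrt_sqNorm_eq]
    exact Fusion.finrank_le_fpDim k A hA.separable hA.connected S.obj
  have hsum : ∀ X : C, (Module.finrank k (X ⟶ A) : ℝ) = ∑ S : Fusion.Irr C,
      (Module.finrank k (S.obj ⟶ X) : ℝ) * Module.finrank k (S.obj ⟶ A) := fun X => by
    exact_mod_cast Fusion.finrank_hom_eq_sum k X A
  have hterm : ∀ (X : C) (S : Fusion.Irr C),
      (Module.finrank k (S.obj ⟶ X) : ℝ) * Module.finrank k (S.obj ⟶ A) ≤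
        Module.finrank k (S.obj ⟶ X) * √(Fusion.toComplex σ (Fusion.sqNorm k S.obj)).re :=
    fun X S => mul_le_mul_of_nonneg_left (hle S) (Nat.cast_nonneg _)
  have hmain : ∀ X : C, (Module.finrank k (X ⟶ A) : ℝ) ≤ Fusion.dim σ X := fun X => by
    rw [hsum, Fusion.dim]
    exact Finset.sum_le_sum fun S _ => hterm X S
  refine ⟨hmain, hmain A, fun hmax X hX ⟨f, hf⟩ => ?_⟩
  rw [Fusion.IsMaximallySymmetric, hsum, Fusion.dim] at hmax
  have heq := (Finset.sum_eq_sum_iff_of_le fun S _ => hterm A S).1 hmax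
  rw [hsum, Fusion.dim]
  refine Finset.sum_congr rfl fun S hS => ?_
  have := Fusion.finite_hom k S.obj X
  have := Fusion.finite_hom k S.obj A
  by_cases h0 : Module.finrank k (S.obj ⟶ X) = 0
  · simp [h0]
  · obtain ⟨g, hg⟩ := Module.finrank_pos_iff_exists_ne_zero.1 (Nat.pos_of_ne_zero h0)
    have := isIso_of_hom_simple hg
    have hgf : g ≫ f ≠ 0 := fun h => hf (by rw [← cancel_epi g, h, comp_zero])
    have hpos : (Module.finrank k (S.obj ⟶ A) : ℝ) ≠ 0 :=
      Nat.cast_ne_zero.2 (Module.finrank_pos_iff_exists_ne_zero.2 ⟨_, hgf⟩).ne'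
    -- Here `S` is isomorphic to `X`, so it occurs in `A` and its nonzero multiplicity can be
    -- cancelled from the termwise equality.
    rw [mul_left_cancel₀ hpos (heq S hS)]
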